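/- **Lemma (Oracle property of the Adaptive Lasso with different sample sizes).** Fix $p$, $\beta^*\in\mathbb R^p$, $\sigma\ge 0$ and $\gamma>0$, and let $S=\{j:\beta^*_j\neq 0\}$. For each $n$ let $X=X_n\in\mathbb R^{n\times p}$ be a deterministic design with rows $x_1^\top,\dots,x_n^\top$, and let $y=X\beta^*+\varepsilon$, where $\varepsilon_1,\dots,\varepsilon_n$ are i.i.d. $\mathcal N(0,\sigma^2)$. Assume that, as $n\to\infty$, $$\tfrac1n X^\top X\to C,\quad C \text{ positive definite},\qquad \tfrac1n\max_i\|x_i\|_2^2\to 0 .$$ Let $m=m_n$ be a sequence of nonnegative integers, and let $\tilde\beta=\tilde\beta_n$ be random vectors in $\mathbb R^p$ (the initial estimator) that are $\sqrt m$-consistent, i.e. $\sqrt{m}\,(\tilde\beta-\beta^*)=O_P(1)$ as $n\to\infty$. Let $\lambda_n\ge 0$ and let $\hat\beta_n$ be the Adaptive Lasso estimator, that is, a random vector which is almost surely a minimizer over $\beta\in\mathbb R^p$ of $$\frac1n\|y-X\beta\|_2^2+\frac{\lambda_n}{n}\sum_{j=1}^p w_j|\beta_j|,\qquad w_j=\frac1{|\tilde\beta_j|^{\gamma}},$$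 with the conventions $w_j=\infty$ if $\tilde\beta_j=0$, and $\infty\cdot 0=0$. Put $\hat S_n=\{j:\hat\beta_{n,j}\neq0\}$. If $\lambda_n/\sqrt n\to0$ and $\lambda_n\sqrt{m^{\gamma}/n}\to\infty$, then $\hat\beta_n$ has the oracle property: 1. (consistent variable selection) $\displaystyle\lim_{n\to\infty}P(\hat S_n=S)=1$; 2. ($\sqrt n$-consistency) $\sqrt n\,(\hat\beta_n-\beta^*)=O_P(1)$; 3. (asymptotic normality) $\sqrt n\,(\hat\beta_{n,S}-\beta^*_S)\xrightarrow{d}\mathcal N(0,\sigma^2C_{SS}^{-1})$. -/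

import Mathlib

open MeasureTheory ProbabilityTheory Filter Topology Matrix
open scoped NNReal ENNReal

/-- The active set `{j : βⱼ ≠ 0}` of a parameter vector. -/
noncomputable def activeSet {p : ℕ} (β : EuclideanSpace ℝ (Fin p)) : Finset (Fin p) :=
  Finset.univ.filter fun j => β j ≠ 0

/-- The subvector `β_S`. -/
noncomputable def subvector {p : ℕ} (S : Finset (Fin p)) (β : EuclideanSpace ℝ (Fin p)) :
    EuclideanSpace ℝ S :=
  WithLp.toLp 2 fun j => β j

/-- The Adaptive Lasso weight `1 / |b|^γ` of a coordinate with initial estimate `b`.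
For `γ > 0` it equals `∞` when `b = 0`. -/
noncomputable def adaptiveWeight (γ b : ℝ) : ℝ≥0∞ :=
  (ENNReal.ofReal (|b| ^ γ))⁻¹

/-- The Adaptive Lasso objective
`(1/n) ‖y - X β‖² + (lam/n) ∑ⱼ wⱼ |βⱼ|` with `wⱼ = 1 / |βinitⱼ|^γ`, for `lam ≥ 0`.
It takes values in `[0, ∞]` with `∞ * 0 = 0`: for `lam > 0`, a coordinate whose initial
estimate is `0` costs `∞` unless it is `0`. -/
noncomputable def adaptiveLassoObjective {n p : ℕ} (X : Matrix (Fin n) (Fin p) ℝ)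
    (y : Fin n → ℝ) (lam γ : ℝ) (βinit β : EuclideanSpace ℝ (Fin p)) : ℝ≥0∞ :=
  ENNReal.ofReal ((1 / n) * ∑ i, (y i - (X *ᵥ β.ofLp) i) ^ 2) +
    ENNReal.ofReal (lam / n) * ∑ j, adaptiveWeight γ (βinit j) * ENNReal.ofReal |β j|

/-- `b` is a minimizer of the Adaptive Lasso objective. -/
def IsAdaptiveLasso {n p : ℕ} (X : Matrix (Fin n) (Fin p) ℝ) (y : Fin n → ℝ) (lam γ : ℝ)
    (βinit b : EuclideanSpace ℝ (Fin p)) : Prop :=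
  ∀ β, adaptiveLassoObjective X y lam γ βinit b ≤ adaptiveLassoObjective X y lam γ βinit β

/-- The estimators `T n` of `θ` are `√(r n)`-consistent: `√(r n) (T n - θ) = O_P(1)`. -/
def IsRootConsistent {Ω E : Type*} [MeasurableSpace Ω] [NormedAddCommGroup E]
    (P : Measure Ω) (r : ℕ → ℕ) (T : ℕ → Ω → E) (θ : E) : Prop :=
  ∀ δ : ℝ, 0 < δ → ∃ M : ℝ, ∀ᶠ n in atTop,
    P {ω | M < √(r n : ℝ) * ‖T n ω - θ‖} ≤ ENNReal.ofReal δ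

/-! Write `u = √n (β̂ - β*)`, `G = XᵀX/n`, `W = Xᵀε/√n`. Minimality against `β̂ + s/√n` gives a
variational inequality in `s`, used for three choices: `s = -u` (return to `β*`), small multiples of
a basis vector (the KKT bound), and the vector that deletes one selected coordinate. Suppose `W` and
`√m (β̃ - β*)` are bounded by `M`. On `S` the weights are then bounded, so, as `λ/√n → 0`, the
choice `s = -u` gives `uᵀGu ≤ O(‖u‖)`; since `G → C` is positive definite, `u` is bounded. A
selected coordinate can only carry a bounded normalized penalty `(λ/√n) w_j`, but off `S` this is at
least `(λ/√n)(√m/M)^γ → ∞`; so nothing off `S` is selected. On `S`, `√n |β*_j|` outgrows the bound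
on `u`, so nothing is lost. The KKT bound on `S` gives `(Cu)_S ≈ W_S`, hence `u_S ≈ C_SS⁻¹ W_S`.
This part is deterministic (`oracle_of_bounded_score`). Probability enters through Chebyshev's bound
on `W`, the Gaussian law of its linear functionals (`tendstoInDistribution_leadingTerm`), and
Slutsky's theorem. -/

/-! ### Reduction to a real-valued objective -/

/-- The Adaptive Lasso objective multiplied by `n`, with real values. It agrees with
`adaptiveLassoObjective` on the `β` that vanish wherever `βinit` does. -/
noncomputable def realAdaptiveObjective {n p : ℕ} (X : Matrix (Fin n) (Fin p) ℝ)
    (y : Fin n → ℝ) (lam γ : ℝ) (βinit β : EuclideanSpace ℝ (Fin p)) : ℝ :=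
  ∑ i, (y i - (X *ᵥ β.ofLp) i) ^ 2 + lam * ∑ j, (|βinit j| ^ γ)⁻¹ * |β j|

lemma adaptiveWeight_zero {γ : ℝ} (hγ : 0 < γ) : adaptiveWeight γ 0 = ⊤ := by
  simp [adaptiveWeight, Real.zero_rpow hγ.ne']

lemma adaptiveWeight_of_ne_zero (γ : ℝ) {b : ℝ} (hb : b ≠ 0) :
    adaptiveWeight γ b = ENNReal.ofReal (|b| ^ γ)⁻¹ := by
  rw [adaptiveWeight, ENNReal.ofReal_inv_of_pos (Real.rpow_pos_of_pos (abs_pos.2 hb) _)]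

lemma adaptiveLassoObjective_eq_ofReal {n p : ℕ} (X : Matrix (Fin n) (Fin p) ℝ)
    (y : Fin n → ℝ) {lam : ℝ} (γ : ℝ) (hlam : 0 ≤ lam) {βinit β : EuclideanSpace ℝ (Fin p)}
    (h : ∀ j, βinit j = 0 → β j = 0) :
    adaptiveLassoObjective X y lam γ βinit β =
      ENNReal.ofReal ((1 / n) * realAdaptiveObjective X y lam γ βinit β) := by
  have hw : ∀ j, 0 ≤ (|βinit j| ^ γ)⁻¹ * |β j| := fun j => by positivity
  have h1 : ∑ j, adaptiveWeight γ (βinit j) * ENNReal.ofReal |β j| =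
      ENNReal.ofReal (∑ j, (|βinit j| ^ γ)⁻¹ * |β j|) := by
    rw [ENNReal.ofReal_sum_of_nonneg fun j _ => hw j]
    refine Finset.sum_congr rfl fun j _ => ?_
    by_cases hj : βinit j = 0
    · simp [h j hj]
    · rw [adaptiveWeight_of_ne_zero γ hj, ENNReal.ofReal_mul (by positivity)]
  rw [adaptiveLassoObjective, h1, ← ENNReal.ofReal_mul (by positivity),
    ← ENNReal.ofReal_add (by positivity)
      (mul_nonneg (by positivity) (Finset.sum_nonneg fun j _ => hw j)), realAdaptiveObjective]
  congr 1
  ring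

lemma eq_zero_of_adaptiveLassoObjective_ne_top {n p : ℕ} {X : Matrix (Fin n) (Fin p) ℝ}
    {y : Fin n → ℝ} {lam γ : ℝ} (hn : 0 < n) (hlam : 0 < lam) (hγ : 0 < γ)
    {βinit β : EuclideanSpace ℝ (Fin p)}
    (h : adaptiveLassoObjective X y lam γ βinit β ≠ ⊤) (j : Fin p) (hj : βinit j = 0) :
    β j = 0 := by
  by_contra hβ
  apply h
  have hn' : (0 : ℝ) < n := by exact_mod_cast hn
  have hs : ∑ k, adaptiveWeight γ (βinit k) * ENNReal.ofReal |β k| = ⊤ := by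
    rw [ENNReal.sum_eq_top]
    refine ⟨j, Finset.mem_univ j, ?_⟩
    rw [hj, adaptiveWeight_zero hγ, ENNReal.top_mul]
    simpa using hβ
  rw [adaptiveLassoObjective, hs, ENNReal.mul_top, add_top]
  simpa using div_pos hlam hn'

/-- The competitor `0` has finite objective, so the minimum is finite and an infinite weight forces
a zero coordinate. This needs `lam > 0`: otherwise the penalty is `0 * ∞ = 0`. -/
lemma IsAdaptiveLasso.eq_zero {n p : ℕ} {X : Matrix (Fin n) (Fin p) ℝ}
    {y : Fin n → ℝ} {lam γ : ℝ} (hn : 0 < n) (hlam : 0 < lam) (hγ : 0 < γ)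
    {βinit b : EuclideanSpace ℝ (Fin p)} (h : IsAdaptiveLasso X y lam γ βinit b)
    (j : Fin p) (hj : βinit j = 0) : b j = 0 := by
  refine eq_zero_of_adaptiveLassoObjective_ne_top hn hlam hγ (X := X) (y := y) ?_ j hj
  refine ne_top_of_le_ne_top ?_ (h 0)
  rw [adaptiveLassoObjective_eq_ofReal X y γ hlam.le (by simp)]
  exact ENNReal.ofReal_ne_top

lemma IsAdaptiveLasso.realAdaptiveObjective_le {n p : ℕ} {X : Matrix (Fin n) (Fin p) ℝ}
    {y : Fin n → ℝ} {lam γ : ℝ} (hn : 0 < n) (hlam : 0 < lam) (hγ : 0 < γ)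
    {βinit b β : EuclideanSpace ℝ (Fin p)} (h : IsAdaptiveLasso X y lam γ βinit b)
    (hβ : ∀ j, βinit j = 0 → β j = 0) :
    realAdaptiveObjective X y lam γ βinit b ≤ realAdaptiveObjective X y lam γ βinit β := by
  have hn' : (0 : ℝ) < n := by exact_mod_cast hn
  have h1 := h β
  have h0 : 0 ≤ realAdaptiveObjective X y lam γ βinit β := by
    unfold realAdaptiveObjective; positivity
  rw [adaptiveLassoObjective_eq_ofReal X y γ hlam.le hβ,
    adaptiveLassoObjective_eq_ofReal X y γ hlam.le (h.eq_zero hn hlam hγ),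
    ENNReal.ofReal_le_ofReal_iff (by positivity)] at h1
  exact le_of_mul_le_mul_left h1 (by positivity)

/-! ### Variational inequalities for the rescaled error -/

/-- The normalized Gram matrix `XᵀX / n`. -/
noncomputable def normalizedGram {n p : ℕ} (X : Matrix (Fin n) (Fin p) ℝ) : Matrix (Fin p) (Fin p) ℝ :=
  (1 / (n : ℝ)) • (Xᵀ * X)

/-- The normalized score `Xᵀe / √n` of the noise `e`. -/
noncomputable def noiseScore {n p : ℕ} (X : Matrix (Fin n) (Fin p) ℝ) (e : Fin n → ℝ) :
    Fin p → ℝ :=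
  (1 / √(n : ℝ)) • (Xᵀ *ᵥ e)

lemma dotProduct_normalizedGram_mulVec {n p : ℕ} (X : Matrix (Fin n) (Fin p) ℝ) (u s : Fin p → ℝ) :
    u ⬝ᵥ normalizedGram X *ᵥ s = (1 / (n : ℝ)) * ((X *ᵥ u) ⬝ᵥ (X *ᵥ s)) := by
  rw [normalizedGram, smul_mulVec, dotProduct_smul, ← mulVec_mulVec, dotProduct_mulVec, vecMul_transpose,
    smul_eq_mul]

lemma noiseScore_dotProduct {n p : ℕ} (X : Matrix (Fin n) (Fin p) ℝ) (e : Fin n → ℝ)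
    (s : Fin p → ℝ) : noiseScore X e ⬝ᵥ s = (1 / √(n : ℝ)) * (e ⬝ᵥ (X *ᵥ s)) := by
  rw [noiseScore, smul_dotProduct, mulVec_transpose, ← dotProduct_mulVec, smul_eq_mul]

lemma normalizedGram_transpose {n p : ℕ} (X : Matrix (Fin n) (Fin p) ℝ) : (normalizedGram X)ᵀ = normalizedGram X := by
  simp [normalizedGram, transpose_smul, transpose_mul]

/-- The variational inequality satisfied by an Adaptive Lasso estimator `b`, in terms of the
rescaled error `√n (b - β*)`. -/
lemma IsAdaptiveLasso.variational {n p : ℕ} {X : Matrix (Fin n) (Fin p) ℝ}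
    {y e : Fin n → ℝ} {lam γ : ℝ} (hn : 0 < n) (hlam : 0 < lam) (hγ : 0 < γ)
    {βinit b βstar : EuclideanSpace ℝ (Fin p)} (hy : ∀ i, y i = (X *ᵥ βstar.ofLp) i + e i)
    (h : IsAdaptiveLasso X y lam γ βinit b) (s : Fin p → ℝ)
    (hs : ∀ j, βinit j = 0 → s j = 0) :
    2 * (noiseScore X e ⬝ᵥ s - (√(n : ℝ) • (b - βstar)).ofLp ⬝ᵥ normalizedGram X *ᵥ s) ≤
      s ⬝ᵥ normalizedGram X *ᵥ s +
        lam * ∑ j, (|βinit j| ^ γ)⁻¹ * (|b j + s j / √(n : ℝ)| - |b j|) := by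
  have hn' : (0 : ℝ) < n := by exact_mod_cast hn
  set r : ℝ := √(n : ℝ) with hr
  have hr0 : 0 < r := Real.sqrt_pos.2 hn'
  have hrn : (n : ℝ) = r * r := (Real.mul_self_sqrt hn'.le).symm
  have hb := h.eq_zero hn hlam hγ
  -- The competitor is `b + s/√n`; it vanishes wherever the weight is infinite, so real objectives
  -- can be compared.
  have hle := h.realAdaptiveObjective_le hn hlam hγ
    (β := b + WithLp.toLp 2 (r⁻¹ • s)) (fun j hj => by simp [hb j hj, hs j hj])
  have hu : ((√(n : ℝ) • (b - βstar)).ofLp) = r • (b.ofLp - βstar.ofLp) := rfl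
  rw [dotProduct_normalizedGram_mulVec, dotProduct_normalizedGram_mulVec, noiseScore_dotProduct, ← hr, hrn]
  have hXu : X *ᵥ (r • (b - βstar)).ofLp = r • (X *ᵥ b.ofLp - X *ᵥ βstar.ofLp) := by
    change X *ᵥ (r • (b.ofLp - βstar.ofLp)) = _
    rw [mulVec_smul, mulVec_sub]
  have hX1 : X *ᵥ (b + WithLp.toLp 2 (r⁻¹ • s)).ofLp = X *ᵥ b.ofLp + r⁻¹ • (X *ᵥ s) := by
    change X *ᵥ (b.ofLp + r⁻¹ • s) = _
    rw [mulVec_add, mulVec_smul]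
  rw [hXu]
  unfold realAdaptiveObjective at hle
  rw [hX1] at hle
  set A := X *ᵥ b.ofLp
  set B := X *ᵥ βstar.ofLp
  set D := X *ᵥ s
  have h2 : ∑ i, (y i - (A + r⁻¹ • D) i) ^ 2 - ∑ i, (y i - A i) ^ 2 =
      1 / (r * r) * (D ⬝ᵥ D) - 2 * (1 / r * (e ⬝ᵥ D) -
        1 / (r * r) * ((r • (A - B)) ⬝ᵥ D)) := by
    simp only [dotProduct, Finset.mul_sum, ← Finset.sum_sub_distrib]
    refine Finset.sum_congr rfl fun i _ => ?_
    rw [hy i]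
    simp only [Pi.add_apply, Pi.smul_apply, Pi.sub_apply, smul_eq_mul]
    field_simp
    ring
  have h3 : ∑ j, (|βinit j| ^ γ)⁻¹ * |(b + WithLp.toLp 2 (r⁻¹ • s)) j| -
      ∑ j, (|βinit j| ^ γ)⁻¹ * |b j| =
      ∑ j, (|βinit j| ^ γ)⁻¹ * (|b j + s j / r| - |b j|) := by
    rw [← Finset.sum_sub_distrib]
    refine Finset.sum_congr rfl fun j _ => ?_
    simp only [PiLp.add_apply, Pi.smul_apply, smul_eq_mul]
    rw [mul_sub, div_eq_inv_mul]
  have h4 : lam * ∑ j, (|βinit j| ^ γ)⁻¹ * |(b + WithLp.toLp 2 (r⁻¹ • s)) j| -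
      lam * ∑ j, (|βinit j| ^ γ)⁻¹ * |b j| =
      lam * ∑ j, (|βinit j| ^ γ)⁻¹ * (|b j + s j / r| - |b j|) := by
    rw [← mul_sub, h3]
  linarith

/-- The variational inequality along a coordinate direction. -/
lemma IsAdaptiveLasso.variational_single {n p : ℕ} {X : Matrix (Fin n) (Fin p) ℝ}
    {y e : Fin n → ℝ} {lam γ : ℝ} (hn : 0 < n) (hlam : 0 < lam) (hγ : 0 < γ)
    {βinit b βstar : EuclideanSpace ℝ (Fin p)} (hy : ∀ i, y i = (X *ᵥ βstar.ofLp) i + e i)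
    (h : IsAdaptiveLasso X y lam γ βinit b) (j : Fin p) (hj : βinit j ≠ 0) (t : ℝ) :
    2 * t * (noiseScore X e j - (normalizedGram X *ᵥ (√(n : ℝ) • (b - βstar)).ofLp) j) ≤
      t ^ 2 * normalizedGram X j j + lam * ((|βinit j| ^ γ)⁻¹ * (|b j + t / √(n : ℝ)| - |b j|)) := by
  have h1 := h.variational hn hlam hγ hy (Pi.single j t) (fun k hk => by
    rw [Pi.single_eq_of_ne]; rintro rfl; exact hj hk)
  have h2 : ∑ k, (|βinit k| ^ γ)⁻¹ * (|b k + (Pi.single j t : Fin p → ℝ) k / √(n : ℝ)| - |b k|) =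
      (|βinit j| ^ γ)⁻¹ * (|b j + t / √(n : ℝ)| - |b j|) := by
    rw [Finset.sum_eq_single j]
    · simp
    · intro k _ hk
      simp [Pi.single_eq_of_ne hk]
    · simp
  rw [h2, dotProduct_mulVec, ← mulVec_transpose, normalizedGram_transpose] at h1
  have h3 : (Pi.single j t : Fin p → ℝ) ⬝ᵥ normalizedGram X *ᵥ (Pi.single j t) = t ^ 2 * normalizedGram X j j := by
    rw [single_dotProduct, mulVec_single]
    simp
    ring
  rw [h3, dotProduct_single, dotProduct_single] at h1
  linarith

/-- Take `t = ±τ`, divide by `τ` and let `τ → 0`: the quadratic term disappears. -/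
lemma two_mul_abs_le_of_forall_quadratic {g A L : ℝ}
    (h : ∀ t : ℝ, 2 * t * g ≤ t ^ 2 * A + |t| * L) : 2 * |g| ≤ L := by
  have key : ∀ τ : ℝ, 0 < τ → 2 * |g| ≤ τ * A + L := by
    intro τ hτ
    have h1 := h τ
    have h2 := h (-τ)
    rw [abs_neg] at h2
    rw [abs_of_pos hτ] at h1 h2
    have h3 : τ * (2 * |g|) ≤ τ * (τ * A + L) := by
      rcases abs_cases g with ⟨hg, _⟩ | ⟨hg, _⟩ <;> rw [hg] <;> linarith
    exact le_of_mul_le_mul_left h3 hτ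
  refine le_of_forall_pos_le_add fun η hη => ?_
  have h1 := key (η / (|A| + 1)) (by positivity)
  have h2 : η / (|A| + 1) * A ≤ η := by
    calc η / (|A| + 1) * A ≤ η / (|A| + 1) * (|A| + 1) := by
          gcongr
          linarith [le_abs_self A]
      _ = η := by field_simp
  linarith

/-- The Karush-Kuhn-Tucker bound on the score of the residual. -/
lemma IsAdaptiveLasso.abs_score_le {n p : ℕ} {X : Matrix (Fin n) (Fin p) ℝ}
    {y e : Fin n → ℝ} {lam γ : ℝ} (hn : 0 < n) (hlam : 0 < lam) (hγ : 0 < γ)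
    {βinit b βstar : EuclideanSpace ℝ (Fin p)} (hy : ∀ i, y i = (X *ᵥ βstar.ofLp) i + e i)
    (h : IsAdaptiveLasso X y lam γ βinit b) (j : Fin p) (hj : βinit j ≠ 0) :
    2 * |noiseScore X e j - (normalizedGram X *ᵥ (√(n : ℝ) • (b - βstar)).ofLp) j| ≤
      lam / √(n : ℝ) * (|βinit j| ^ γ)⁻¹ := by
  refine two_mul_abs_le_of_forall_quadratic (A := normalizedGram X j j) fun t => ?_
  refine (h.variational_single hn hlam hγ hy j hj t).trans ?_
  have h1 : |b j + t / √(n : ℝ)| - |b j| ≤ |t| / √(n : ℝ) := by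
    have := abs_add_le (b j) (t / √(n : ℝ))
    rw [abs_div, abs_of_nonneg (Real.sqrt_nonneg (n : ℝ))] at this
    linarith
  have h2 : lam * ((|βinit j| ^ γ)⁻¹ * (|b j + t / √(n : ℝ)| - |b j|)) ≤
      lam * ((|βinit j| ^ γ)⁻¹ * (|t| / √(n : ℝ))) := by gcongr
  calc _ ≤ t ^ 2 * normalizedGram X j j + lam * ((|βinit j| ^ γ)⁻¹ * (|t| / √(n : ℝ))) := by linarith
    _ = _ := by ring

/-- A coordinate that the Adaptive Lasso selects carries a bounded penalty. -/
lemma IsAdaptiveLasso.weight_le_of_selected {n p : ℕ} {X : Matrix (Fin n) (Fin p) ℝ}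
    {y e : Fin n → ℝ} {lam γ : ℝ} (hn : 0 < n) (hlam : 0 < lam) (hγ : 0 < γ)
    {βinit b βstar : EuclideanSpace ℝ (Fin p)} (hy : ∀ i, y i = (X *ᵥ βstar.ofLp) i + e i)
    (h : IsAdaptiveLasso X y lam γ βinit b) (j : Fin p) (hb : b j ≠ 0) :
    lam / √(n : ℝ) * (|βinit j| ^ γ)⁻¹ ≤
      2 * |noiseScore X e j - (normalizedGram X *ᵥ (√(n : ℝ) • (b - βstar)).ofLp) j| +
        √(n : ℝ) * |b j| * normalizedGram X j j := by
  have hr0 : 0 < √(n : ℝ) := Real.sqrt_pos.2 (by exact_mod_cast hn)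
  -- This step length sends coordinate `j` to `0`, so the whole of its penalty is saved.
  have h1 := h.variational_single hn hlam hγ hy j
    (fun hj => hb (h.eq_zero hn hlam hγ j hj)) (-(√(n : ℝ) * b j))
  set g := noiseScore X e j - (normalizedGram X *ᵥ (√(n : ℝ) • (b - βstar)).ofLp) j
  set r := √(n : ℝ)
  have h2 : b j + -(r * b j) / r = 0 := by field_simp; ring
  rw [h2, abs_zero, zero_sub] at h1
  have h3 : b j * g ≤ |b j| * |g| := by rw [← abs_mul]; exact le_abs_self _
  have h4 : (-(r * b j)) ^ 2 = r * |b j| * (r * |b j|) := by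
    rw [neg_sq, mul_pow, ← sq_abs (b j)]; ring
  rw [h4] at h1
  have h5 : r * |b j| * (lam / r * (|βinit j| ^ γ)⁻¹) = lam * ((|βinit j| ^ γ)⁻¹ * |b j|) := by
    field_simp
  have h6 : r * (b j * g) ≤ r * (|b j| * |g|) := by gcongr
  have h7 : 0 < r * |b j| := by positivity
  refine le_of_mul_le_mul_left ?_ h7
  rw [h5]
  linarith

/-- The basic inequality for the rescaled error. -/
lemma IsAdaptiveLasso.quadratic_le {n p : ℕ} {X : Matrix (Fin n) (Fin p) ℝ}
    {y e : Fin n → ℝ} {lam γ : ℝ} (hn : 0 < n) (hlam : 0 < lam) (hγ : 0 < γ)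
    {βinit b βstar : EuclideanSpace ℝ (Fin p)} (hy : ∀ i, y i = (X *ᵥ βstar.ofLp) i + e i)
    (h : IsAdaptiveLasso X y lam γ βinit b) (hadm : ∀ j, βinit j = 0 → βstar j = 0)
    {K : ℝ} (hK : 0 ≤ K) (hw : ∀ j, βstar j ≠ 0 → (|βinit j| ^ γ)⁻¹ ≤ K) :
    (√(n : ℝ) • (b - βstar)).ofLp ⬝ᵥ normalizedGram X *ᵥ (√(n : ℝ) • (b - βstar)).ofLp ≤
      2 * (noiseScore X e ⬝ᵥ (√(n : ℝ) • (b - βstar)).ofLp) +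
        lam / √(n : ℝ) * K * ∑ j, |(√(n : ℝ) • (b - βstar)) j| := by
  have hr0 : 0 < √(n : ℝ) := Real.sqrt_pos.2 (by exact_mod_cast hn)
  have hb := h.eq_zero hn hlam hγ
  -- The direction `-u` moves `b` back to `βstar`.
  have h1 := h.variational hn hlam hγ hy (-(√(n : ℝ) • (b - βstar)).ofLp)
    (fun j hj => by simp [hb j hj, hadm j hj])
  rw [mulVec_neg, dotProduct_neg, dotProduct_neg, neg_dotProduct, dotProduct_neg, neg_neg] at h1
  have h2 : lam * ∑ j, (|βinit j| ^ γ)⁻¹ *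
      (|b j + (-(√(n : ℝ) • (b - βstar)).ofLp) j / √(n : ℝ)| - |b j|) ≤
      lam / √(n : ℝ) * K * ∑ j, |(√(n : ℝ) • (b - βstar)) j| := by
    have e0 : lam / √(n : ℝ) * K * ∑ j, |(√(n : ℝ) • (b - βstar)) j| =
        lam * ∑ j, (√(n : ℝ))⁻¹ * (K * |(√(n : ℝ) • (b - βstar)) j|) := by
      rw [← Finset.mul_sum, ← Finset.mul_sum]
      ring
    rw [e0]
    refine mul_le_mul_of_nonneg_left (Finset.sum_le_sum fun j _ => ?_) hlam.le
    have e1 : b j + (-(√(n : ℝ) • (b - βstar)).ofLp) j / √(n : ℝ) = βstar j := by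
      simp only [Pi.neg_apply, PiLp.smul_apply, PiLp.sub_apply, smul_eq_mul]
      field_simp
      ring
    have e2 : |(√(n : ℝ) • (b - βstar)) j| = √(n : ℝ) * |b j - βstar j| := by
      simp [abs_mul, abs_of_pos hr0]
    rw [e1, e2]
    -- Off the support the return to `βstar` only lowers the penalty, however large the weight; on
    -- it the weight is at most `K`.
    by_cases hj : βstar j = 0
    · rw [hj, abs_zero, zero_sub]
      have a1 : (|βinit j| ^ γ)⁻¹ * -|b j| ≤ 0 :=
        mul_nonpos_of_nonneg_of_nonpos (by positivity) (by simp)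
      exact a1.trans (by positivity)
    · have a1 : |βstar j| - |b j| ≤ |b j - βstar j| := by
        rw [abs_sub_comm]; exact abs_sub_abs_le_abs_sub _ _
      have a2 : (√(n : ℝ))⁻¹ * (K * (√(n : ℝ) * |b j - βstar j|)) = K * |b j - βstar j| := by
        field_simp
      rw [a2]
      calc _ ≤ (|βinit j| ^ γ)⁻¹ * |b j - βstar j| := by gcongr
        _ ≤ _ := by gcongr; exact hw j hj
  linarith

/-! ### Matrix bounds and growth rates -/

lemma EuclideanSpace.abs_apply_le_norm {ι : Type*} [Fintype ι] (u : EuclideanSpace ℝ ι) (j : ι) :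
    |u j| ≤ ‖u‖ := by
  simpa using PiLp.norm_apply_le u j

lemma abs_mulVec_apply_le {ι : Type*} [Fintype ι] (D : Matrix ι ι ℝ) (u : EuclideanSpace ℝ ι)
    (j : ι) : |(D *ᵥ u.ofLp) j| ≤ (∑ i, ∑ k, |D i k|) * ‖u‖ := by
  have h1 : |(D *ᵥ u.ofLp) j| ≤ ∑ k, |D j k| * ‖u‖ := by
    refine (Finset.abs_sum_le_sum_abs _ _).trans (Finset.sum_le_sum fun k _ => ?_)
    rw [abs_mul]
    gcongr
    exact u.abs_apply_le_norm k
  rw [← Finset.sum_mul] at h1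
  refine h1.trans (mul_le_mul_of_nonneg_right ?_ (norm_nonneg u))
  exact Finset.single_le_sum (f := fun i => ∑ k, |D i k|)
    (fun i _ => Finset.sum_nonneg fun k _ => abs_nonneg _) (Finset.mem_univ j)

lemma abs_dotProduct_mulVec_le {ι : Type*} [Fintype ι] (D : Matrix ι ι ℝ)
    (u : EuclideanSpace ℝ ι) :
    |u.ofLp ⬝ᵥ D *ᵥ u.ofLp| ≤ (∑ i, ∑ k, |D i k|) * ‖u‖ ^ 2 := by
  rw [Finset.sum_mul]
  refine (Finset.abs_sum_le_sum_abs _ _).trans (Finset.sum_le_sum fun i _ => ?_)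
  rw [abs_mul, Finset.sum_mul]
  have h1 : |(D *ᵥ u.ofLp) i| ≤ ∑ k, |D i k| * ‖u‖ := by
    refine (Finset.abs_sum_le_sum_abs _ _).trans (Finset.sum_le_sum fun k _ => ?_)
    rw [abs_mul]
    gcongr
    exact u.abs_apply_le_norm k
  calc |u i| * |(D *ᵥ u.ofLp) i| ≤ ‖u‖ * ∑ k, |D i k| * ‖u‖ := by
        gcongr
        exact u.abs_apply_le_norm i
    _ = _ := by
        rw [Finset.mul_sum]
        exact Finset.sum_congr rfl fun k _ => by ring

/-- The constant is the minimum of the quadratic form on the compact unit sphere, extended by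
homogeneity. The sphere is empty when `ι` is, and then every vector is `0`. -/
lemma Matrix.PosDef.exists_pos_mul_norm_sq_le {ι : Type*} [Fintype ι] {C : Matrix ι ι ℝ}
    (hC : C.PosDef) :
    ∃ c : ℝ, 0 < c ∧ ∀ u : EuclideanSpace ℝ ι, c * ‖u‖ ^ 2 ≤ u.ofLp ⬝ᵥ C *ᵥ u.ofLp := by
  have hpos : ∀ u : EuclideanSpace ℝ ι, u ≠ 0 → 0 < u.ofLp ⬝ᵥ C *ᵥ u.ofLp := fun u hu => by
    have := hC.dotProduct_mulVec_pos (x := u.ofLp) (by simpa using hu)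
    simpa using this
  rcases (Metric.sphere (0 : EuclideanSpace ℝ ι) 1).eq_empty_or_nonempty with he | hne
  · refine ⟨1, one_pos, fun u => ?_⟩
    have hu : u = 0 := by
      by_contra hu
      have : ‖u‖⁻¹ • u ∈ Metric.sphere (0 : EuclideanSpace ℝ ι) 1 := by
        simp [norm_smul, norm_ne_zero_iff.2 hu]
      simp [he] at this
    simp [hu]
  · have hcont : Continuous fun u : EuclideanSpace ℝ ι => u.ofLp ⬝ᵥ C *ᵥ u.ofLp := by
      fun_prop
    obtain ⟨v, hv, hmin⟩ := (isCompact_sphere (0 : EuclideanSpace ℝ ι) 1).exists_isMinOn hne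
      hcont.continuousOn
    have hv1 : ‖v‖ = 1 := by simpa using hv
    refine ⟨_, hpos v (by rintro rfl; simp at hv1), fun u => ?_⟩
    by_cases hu : u = 0
    · simp [hu]
    have hn : 0 < ‖u‖ := norm_pos_iff.2 hu
    have h1 := hmin (show ‖u‖⁻¹ • u ∈ Metric.sphere (0 : EuclideanSpace ℝ ι) 1 by
      simp [norm_smul, hn.ne'])
    have h2 : (‖u‖⁻¹ • u).ofLp ⬝ᵥ C *ᵥ (‖u‖⁻¹ • u).ofLp =
        (‖u‖ ^ 2)⁻¹ * (u.ofLp ⬝ᵥ C *ᵥ u.ofLp) := by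
      rw [WithLp.ofLp_smul, mulVec_smul, smul_dotProduct, dotProduct_smul, smul_eq_mul,
        smul_eq_mul, ← mul_assoc, sq, mul_inv]
    have h1' : v.ofLp ⬝ᵥ C *ᵥ v.ofLp ≤ (‖u‖⁻¹ • u).ofLp ⬝ᵥ C *ᵥ (‖u‖⁻¹ • u).ofLp := h1
    rw [h2, inv_mul_eq_div, le_div_iff₀ (by positivity)] at h1'
    exact h1'

lemma tendsto_sum_abs_sub_zero {ι : Type*} [Fintype ι] {A : ℕ → Matrix ι ι ℝ} {C : Matrix ι ι ℝ}
    (h : Tendsto A atTop (𝓝 C)) :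
    Tendsto (fun n => ∑ i, ∑ k, |(A n - C) i k|) atTop (𝓝 0) := by
  have h1 : Tendsto (fun n => ∑ i, ∑ k, |(A n - C) i k|) atTop (𝓝 (∑ i : ι, ∑ k : ι, (0 : ℝ))) := by
    refine tendsto_finsetSum _ fun i _ => tendsto_finsetSum _ fun k _ => ?_
    have h2 := (tendsto_pi_nhds.1 (tendsto_pi_nhds.1 h i) k).sub_const (C i k)
    simpa using h2.abs
  simpa using h1

lemma sqrt_rpow_div_eq {m n : ℕ} (γ lam : ℝ) :
    lam * √((m : ℝ) ^ γ / (n : ℝ)) = lam / √(n : ℝ) * √(m : ℝ) ^ γ := by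
  rw [Real.sqrt_div (by positivity), Real.sqrt_eq_rpow ((m : ℝ) ^ γ), Real.sqrt_eq_rpow (m : ℝ),
    ← Real.rpow_mul (by positivity), ← Real.rpow_mul (by positivity), mul_comm γ]
  ring

/-- Once `lam n / √n ≤ 1`, the divergence of the product must come from the factor `√m ^ γ`. -/
lemma tendsto_sqrt_initial_rate {m : ℕ → ℕ} {lam : ℕ → ℝ} {γ : ℝ} (hγ : 0 < γ)
    (hlam_zero : Tendsto (fun n : ℕ => lam n / √(n : ℝ)) atTop (𝓝 0))
    (hlam_top : Tendsto (fun n : ℕ => lam n / √(n : ℝ) * √(m n : ℝ) ^ γ) atTop atTop) :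
    Tendsto (fun n => √(m n : ℝ)) atTop atTop := by
  rw [tendsto_atTop]
  intro R
  filter_upwards [hlam_zero.eventually_le_const one_pos,
    hlam_top.eventually_gt_atTop ((max R 0) ^ γ)] with n h1 h2
  have h3 : 0 ≤ √(m n : ℝ) ^ γ := by positivity
  have h4 : (max R 0) ^ γ < √(m n : ℝ) ^ γ := by nlinarith
  exact (le_max_left R 0).trans
    ((Real.rpow_lt_rpow_iff (le_max_right _ _) (Real.sqrt_nonneg _) hγ).1 h4).le

lemma eventually_forall_lt_mul_abs {p : ℕ} {a : ℕ → ℝ} (ha : Tendsto a atTop atTop)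
    (β : EuclideanSpace ℝ (Fin p)) (R : ℝ) :
    ∀ᶠ n in atTop, ∀ j, β j ≠ 0 → R < a n * |β j| := by
  rw [eventually_all]
  intro j
  by_cases hj : β j = 0
  · simp [hj]
  · filter_upwards [(ha.atTop_mul_const (abs_pos.2 hj)).eventually_gt_atTop R] with n hn _
    exact hn

/-! ### The deterministic oracle property -/

/-- Deterministic form of the oracle property: for all large `n`, a bounded noise score and a
bounded rescaled initial error force the conclusions. -/
theorem oracle_of_bounded_score {p : ℕ}
    (X : (n : ℕ) → Matrix (Fin n) (Fin p) ℝ) (βstar : EuclideanSpace ℝ (Fin p))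
    {C : Matrix (Fin p) (Fin p) ℝ} (hC : C.PosDef)
    (hXC : Tendsto (fun n : ℕ => normalizedGram (X n)) atTop (𝓝 C))
    (m : ℕ → ℕ) {γ : ℝ} (hγ : 0 < γ) {lam : ℕ → ℝ}
    (hlam_zero : Tendsto (fun n : ℕ => lam n / √(n : ℝ)) atTop (𝓝 0))
    (hlam_top : Tendsto (fun n : ℕ => lam n / √(n : ℝ) * √(m n : ℝ) ^ γ) atTop atTop)
    {M : ℝ} (hM : 0 < M) :
    ∃ U : ℝ, ∀ η : ℝ, 0 < η → ∀ᶠ n in atTop, ∀ (y e : Fin n → ℝ)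
      (βinit b : EuclideanSpace ℝ (Fin p)), (∀ i, y i = (X n *ᵥ βstar.ofLp) i + e i) →
      IsAdaptiveLasso (X n) y (lam n) γ βinit b → (∀ j, |noiseScore (X n) e j| ≤ M) →
      √(m n : ℝ) * ‖βinit - βstar‖ ≤ M →
      √(n : ℝ) * ‖b - βstar‖ ≤ U ∧ activeSet b = activeSet βstar ∧
        ∀ j ∈ activeSet βstar,
          |noiseScore (X n) e j - (C *ᵥ (√(n : ℝ) • (b - βstar)).ofLp) j| ≤ η := by
  obtain ⟨c, hc, hcC⟩ := hC.exists_pos_mul_norm_sq_le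
  -- For large `n`, `T` bounds the entries of the Gram matrix and `K` the weights on the support.
  -- `U` solves `(c/2) ‖u‖² ≤ (2pM + p) ‖u‖`, where `c/2` is what remains of `c` after replacing the
  -- Gram matrix by `C`.
  set T : ℝ := ∑ i, ∑ k, |C i k| + 1 with hT
  set K : ℝ := ∑ j, ((|βstar j| / 2) ^ γ)⁻¹ with hK
  have hK0 : 0 ≤ K := Finset.sum_nonneg fun j _ => by positivity
  have hT0 : 0 ≤ T := by positivity
  set U : ℝ := (2 * p * M + p) / (c / 2) with hU
  have hU0 : 0 ≤ U := by positivity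
  -- `U` is independent of `η`: the error bound stays fixed while the accuracy of the linearization
  -- is arbitrary.
  refine ⟨U, fun η hη => ?_⟩
  have hκ := tendsto_sum_abs_sub_zero hXC
  have hsm := tendsto_sqrt_initial_rate hγ hlam_zero hlam_top
  have hsn : Tendsto (fun n : ℕ => √(n : ℝ)) atTop atTop :=
    Real.tendsto_sqrt_atTop.comp tendsto_natCast_atTop_atTop
  have hlamK : Tendsto (fun n : ℕ => lam n / √(n : ℝ) * K) atTop (𝓝 0) := by
    simpa using hlam_zero.mul_const K
  have hκU : Tendsto (fun n => (∑ i, ∑ k, |(normalizedGram (X n) - C) i k|) * U) atTop (𝓝 0) := by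
    simpa using hκ.mul_const U
  filter_upwards [eventually_gt_atTop 0, hκ.eventually_le_const (half_pos hc),
    hκ.eventually_le_const one_pos, hκU.eventually_le_const (half_pos hη),
    hlamK.eventually_le_const one_pos, hlamK.eventually_le_const hη,
    hlam_top.eventually_gt_atTop (M ^ γ * (2 * (M + T * U) + U * T)),
    eventually_forall_lt_mul_abs hsm βstar (2 * M), eventually_forall_lt_mul_abs hsn βstar U,
    hsm.eventually_gt_atTop 0]
    with n hn hκc hκ1 hκη hl1 hlη htop hSm hSn hm0 y e βinit b hy hb hW hinit
  have hr0 : 0 < √(n : ℝ) := Real.sqrt_pos.2 (by exact_mod_cast hn)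
  have hM' : 0 < M ^ γ * (2 * (M + T * U) + U * T) := by positivity
  have hlr : 0 < lam n / √(n : ℝ) :=
    pos_of_mul_pos_left (hM'.trans htop) (by positivity)
  have hlam : 0 < lam n := by
    have := mul_pos hlr hr0
    rwa [div_mul_cancel₀ _ hr0.ne'] at this
  have hinit' : ∀ j, √(m n : ℝ) * |βinit j - βstar j| ≤ M := fun j => by
    refine le_trans ?_ hinit
    gcongr
    exact EuclideanSpace.abs_apply_le_norm (βinit - βstar) j
  -- The initial error is below `|βstar j| / 2` because `√m |βstar j| > 2M`.
  have hhalf : ∀ j, βstar j ≠ 0 → |βstar j| / 2 ≤ |βinit j| := fun j hj => by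
    have h1 := hSm j hj
    have h2 := hinit' j
    have h3 : |βstar j| - |βinit j| ≤ |βinit j - βstar j| := by
      rw [abs_sub_comm]; exact abs_sub_abs_le_abs_sub _ _
    have h4 : √(m n : ℝ) * (2 * |βinit j - βstar j|) < √(m n : ℝ) * |βstar j| := by linarith
    have h5 := lt_of_mul_lt_mul_left h4 hm0.le
    linarith
  have hinit0 : ∀ j, βstar j ≠ 0 → βinit j ≠ 0 := fun j hj h0 => by
    have h1 := hhalf j hj
    rw [h0, abs_zero] at h1
    linarith [abs_pos.2 hj]
  have hw : ∀ j, βstar j ≠ 0 → (|βinit j| ^ γ)⁻¹ ≤ K := fun j hj => by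
    have h0 : 0 < |βstar j| := abs_pos.2 hj
    calc (|βinit j| ^ γ)⁻¹ ≤ ((|βstar j| / 2) ^ γ)⁻¹ := by
          gcongr
          exact hhalf j hj
      _ ≤ K := Finset.single_le_sum (f := fun j => ((|βstar j| / 2) ^ γ)⁻¹)
          (fun j _ => by positivity) (Finset.mem_univ j)
  set u : EuclideanSpace ℝ (Fin p) := √(n : ℝ) • (b - βstar) with hu
  have hun : ‖u‖ = √(n : ℝ) * ‖b - βstar‖ := by
    rw [hu, norm_smul, Real.norm_of_nonneg hr0.le]
  have huU : ‖u‖ ≤ U := by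
    have h1 := hb.quadratic_le hn hlam hγ hy
      (fun j hj => by_contra fun h => hinit0 j h hj) hK0 hw
    rw [← hu] at h1
    have h2 := hcC u
    have h3 := abs_dotProduct_mulVec_le (normalizedGram (X n) - C) u
    rw [sub_mulVec, dotProduct_sub] at h3
    have h4 : noiseScore (X n) e ⬝ᵥ u.ofLp ≤ p * (M * ‖u‖) := by
      calc noiseScore (X n) e ⬝ᵥ u.ofLp ≤ ∑ j : Fin p, M * ‖u‖ := by
            refine Finset.sum_le_sum fun j _ => (le_abs_self _).trans ?_
            rw [abs_mul]
            exact mul_le_mul (hW j) (u.abs_apply_le_norm j) (abs_nonneg _) hM.le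
        _ = _ := by simp
    have h5 : ∑ j, |u j| ≤ p * ‖u‖ := by
      calc ∑ j, |u j| ≤ ∑ j : Fin p, ‖u‖ := Finset.sum_le_sum fun j _ => u.abs_apply_le_norm j
        _ = _ := by simp
    have h6 : lam n / √(n : ℝ) * K * ∑ j, |u j| ≤ 1 * (p * ‖u‖) :=
      mul_le_mul hl1 h5 (Finset.sum_nonneg fun j _ => abs_nonneg _) zero_le_one
    have h7 : (∑ i, ∑ k, |(normalizedGram (X n) - C) i k|) * ‖u‖ ^ 2 ≤ c / 2 * ‖u‖ ^ 2 := by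
      gcongr
    have h8 := neg_abs_le (u.ofLp ⬝ᵥ normalizedGram (X n) *ᵥ u.ofLp - u.ofLp ⬝ᵥ C *ᵥ u.ofLp)
    have h9 : ‖u‖ * (c / 2 * ‖u‖) ≤ ‖u‖ * (2 * p * M + p) := by nlinarith
    rw [hU, le_div_iff₀ (by positivity)]
    rcases (norm_nonneg u).eq_or_lt with h0 | h0
    · rw [← h0, zero_mul]; positivity
    · linarith [le_of_mul_le_mul_left h9 h0]
  have hsum : ∑ i, ∑ k, |normalizedGram (X n) i k| ≤ T := by
    have h1 : ∀ i k, |normalizedGram (X n) i k| ≤ |C i k| + |(normalizedGram (X n) - C) i k| :=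
      fun i k => by
        have := abs_add_le (C i k) ((normalizedGram (X n) - C) i k)
        simpa using this
    calc ∑ i, ∑ k, |normalizedGram (X n) i k|
        ≤ ∑ i, ∑ k, (|C i k| + |(normalizedGram (X n) - C) i k|) :=
          Finset.sum_le_sum fun i _ => Finset.sum_le_sum fun k _ => h1 i k
      _ = ∑ i, ∑ k, |C i k| + ∑ i, ∑ k, |(normalizedGram (X n) - C) i k| := by
          simp only [Finset.sum_add_distrib]
      _ ≤ T := by rw [hT]; gcongr
  have hdiag : ∀ j, normalizedGram (X n) j j ≤ T := fun j => by
    refine le_trans ?_ hsum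
    refine (le_abs_self _).trans ?_
    refine (Finset.single_le_sum (f := fun k => |normalizedGram (X n) j k|)
      (fun k _ => abs_nonneg _) (Finset.mem_univ j)).trans ?_
    exact Finset.single_le_sum (f := fun i => ∑ k, |normalizedGram (X n) i k|)
      (fun i _ => Finset.sum_nonneg fun k _ => abs_nonneg _) (Finset.mem_univ j)
  have hrb : ∀ j, √(n : ℝ) * |b j - βstar j| ≤ U := fun j => by
    refine le_trans ?_ huU
    rw [hun]
    gcongr
    exact EuclideanSpace.abs_apply_le_norm (b - βstar) j
  refine ⟨hun ▸ huU, ?_, ?_⟩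
  · ext j
    simp only [activeSet, Finset.mem_filter, Finset.mem_univ, true_and]
    refine ⟨fun hbj hj => ?_, fun hj hbj => ?_⟩
    -- Selecting `j` off the support bounds its normalized penalty, while `|βinit j| ≤ M / √m` makes
    -- that penalty exceed the bound.
    · have hij : βinit j ≠ 0 := fun h0 => hbj (hb.eq_zero hn hlam hγ j h0)
      have h1 := hb.weight_le_of_selected hn hlam hγ hy j hbj
      rw [← hu] at h1
      have h2 : |noiseScore (X n) e j - (normalizedGram (X n) *ᵥ u.ofLp) j| ≤ M + T * U := by
        refine (abs_sub _ _).trans (add_le_add (hW j) ?_)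
        exact (abs_mulVec_apply_le _ u j).trans (by gcongr)
      have h3 : √(n : ℝ) * |b j| * normalizedGram (X n) j j ≤ U * T := by
        have := hrb j
        rw [hj, sub_zero] at this
        calc _ ≤ √(n : ℝ) * |b j| * T := by gcongr; exact hdiag j
          _ ≤ U * T := by gcongr
      have h4 : √(m n : ℝ) ^ γ * |βinit j| ^ γ ≤ M ^ γ := by
        rw [← Real.mul_rpow (by positivity) (by positivity)]
        have := hinit' j
        rw [hj, sub_zero] at this
        exact Real.rpow_le_rpow (by positivity) this hγ.le
      have hv : 0 < |βinit j| ^ γ := Real.rpow_pos_of_pos (abs_pos.2 hij) _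
      have h5 : √(m n : ℝ) ^ γ ≤ M ^ γ * (|βinit j| ^ γ)⁻¹ := by
        rw [← div_eq_mul_inv, le_div_iff₀ hv]; exact h4
      have h6 : lam n / √(n : ℝ) * √(m n : ℝ) ^ γ ≤
          M ^ γ * (2 * (M + T * U) + U * T) := by
        calc lam n / √(n : ℝ) * √(m n : ℝ) ^ γ
            ≤ lam n / √(n : ℝ) * (M ^ γ * (|βinit j| ^ γ)⁻¹) := by gcongr
          _ = M ^ γ * (lam n / √(n : ℝ) * (|βinit j| ^ γ)⁻¹) := by ring
          _ ≤ _ := by gcongr; linarith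
      linarith
    · have h1 := hrb j
      rw [hbj, zero_sub, abs_neg] at h1
      linarith [hSn j hj]
  · intro j hj
    have hj' : βstar j ≠ 0 := by simpa [activeSet] using hj
    have h1 := hb.abs_score_le hn hlam hγ hy j (hinit0 j hj')
    rw [← hu] at h1
    have h2 : lam n / √(n : ℝ) * (|βinit j| ^ γ)⁻¹ ≤ η := by
      refine le_trans ?_ hlη
      gcongr
      exact hw j hj'
    have h3 : |((normalizedGram (X n) - C) *ᵥ u.ofLp) j| ≤ η / 2 := by
      refine (abs_mulVec_apply_le _ u j).trans (le_trans ?_ hκη)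
      gcongr
    -- Half of `η` pays for the KKT bound, half for replacing the Gram matrix by `C`.
    have h4 : noiseScore (X n) e j - (C *ᵥ u.ofLp) j =
        (noiseScore (X n) e j - (normalizedGram (X n) *ᵥ u.ofLp) j) +
          ((normalizedGram (X n) - C) *ᵥ u.ofLp) j := by
      rw [sub_mulVec, Pi.sub_apply]; ring
    rw [h4]
    refine (abs_add_le _ _).trans ?_
    linarith

/-! ### Gaussian law and boundedness of the score -/

/-- Independence turns the characteristic function into a product of Gaussian ones, whose exponents
add. -/
lemma hasLaw_sum_mul_gaussianReal {Ω ι : Type*} [MeasurableSpace Ω] [Fintype ι] {P : Measure Ω}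
    [IsProbabilityMeasure P] {ε : ι → Ω → ℝ} {v : ℝ≥0}
    (hlaw : ∀ i, HasLaw (ε i) (gaussianReal 0 v) P) (hind : iIndepFun ε P) (a : ι → ℝ) :
    HasLaw (fun ω => ∑ i, a i * ε i ω)
      (gaussianReal 0 (v * (∑ i, a i ^ 2).toNNReal)) P := by
  have hm : ∀ i, AEMeasurable (fun ω => a i * ε i ω) P :=
    fun i => (hlaw i).aemeasurable.const_mul _
  have hmS : AEMeasurable (fun ω => ∑ i, a i * ε i ω) P :=
    Finset.aemeasurable_fun_sum _ fun i _ => hm i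
  refine ⟨hmS, ?_⟩
  have : IsProbabilityMeasure (P.map fun ω => ∑ i, a i * ε i ω) :=
    Measure.isProbabilityMeasure_map hmS
  refine Measure.ext_of_charFun ?_
  have hind' : iIndepFun (fun i ω => a i * ε i ω) P :=
    hind.comp (fun i x => a i * x) fun i => measurable_const_mul _
  rw [hind'.charFun_map_fun_sum_eq_prod hm]
  ext t
  rw [Finset.prod_apply]
  have h1 : ∀ i, charFun (P.map fun ω => a i * ε i ω) t =
      Complex.exp (-((v : ℝ) * (a i * t) ^ 2 / 2 : ℝ)) := fun i => by
    rw [charFun_map_mul_comp (hlaw i).aemeasurable, (hlaw i).map_eq, charFun_gaussianReal]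
    push_cast
    congr 1
    ring
  have h0 : 0 ≤ ∑ i, a i ^ 2 := Finset.sum_nonneg fun i _ => sq_nonneg _
  rw [Finset.prod_congr rfl fun i _ => h1 i, ← Complex.exp_sum, charFun_gaussianReal]
  congr 1
  rw [NNReal.coe_mul, Real.coe_toNNReal _ h0, Finset.sum_neg_distrib]
  push_cast
  simp only [mul_zero, zero_mul, zero_sub, Finset.mul_sum, Finset.sum_mul, Finset.sum_div]
  congr 1
  exact Finset.sum_congr rfl fun i _ => by ring

lemma hasLaw_noiseScore_dotProduct {Ω : Type*} [MeasurableSpace Ω] {P : Measure Ω}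
    [IsProbabilityMeasure P] {n p : ℕ} (X : Matrix (Fin n) (Fin p) ℝ) {ε : Fin n → Ω → ℝ} {v : ℝ≥0}
    (hlaw : ∀ i, HasLaw (ε i) (gaussianReal 0 v) P) (hind : iIndepFun ε P) (z : Fin p → ℝ) :
    HasLaw (fun ω => noiseScore X (fun i => ε i ω) ⬝ᵥ z)
      (gaussianReal 0 (v * (z ⬝ᵥ normalizedGram X *ᵥ z).toNNReal)) P := by
  have h := hasLaw_sum_mul_gaussianReal hlaw hind (fun i => 1 / √(n : ℝ) * (X *ᵥ z) i)
  have h1 : ∑ i, (1 / √(n : ℝ) * (X *ᵥ z) i) ^ 2 = z ⬝ᵥ normalizedGram X *ᵥ z := by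
    rw [dotProduct_normalizedGram_mulVec, dotProduct, Finset.mul_sum]
    refine Finset.sum_congr rfl fun i _ => ?_
    rw [mul_pow, div_pow, Real.sq_sqrt (by positivity), one_pow, sq ((X *ᵥ z) i)]
  rw [h1] at h
  convert! h using 2 with ω
  rw [noiseScore_dotProduct, dotProduct, Finset.mul_sum]
  exact Finset.sum_congr rfl fun i _ => by ring

lemma measure_abs_gt_le_of_hasLaw_gaussianReal {Ω : Type*} [MeasurableSpace Ω] {P : Measure Ω}
    [IsProbabilityMeasure P] {Y : Ω → ℝ} {v : ℝ≥0} (hY : HasLaw Y (gaussianReal 0 v) P) {M : ℝ}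
    (hM : 0 < M) : P {ω | M < |Y ω|} ≤ ENNReal.ofReal (v / M ^ 2) := by
  have hL : MemLp Y 2 P := by
    have h : MemLp id 2 (P.map Y) := by
      rw [hY.map_eq]; exact memLp_id_gaussianReal 2
    exact (memLp_map_measure_iff (by fun_prop) hY.aemeasurable).1 h
  have h := meas_ge_le_variance_div_sq hL hM
  have h0 : P[Y] = 0 := by rw [hY.integral_eq]; exact integral_id_gaussianReal
  rw [hY.variance_eq, variance_id_gaussianReal, h0] at h
  refine (measure_mono fun ω hω => ?_).trans h
  simpa using (le_of_lt hω : M ≤ |Y ω|)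

/-- The normalized score of Gaussian noise is bounded in probability. -/
lemma exists_noiseScore_bound {Ω : Type*} [MeasurableSpace Ω] {P : Measure Ω}
    [IsProbabilityMeasure P] {p : ℕ} {X : (n : ℕ) → Matrix (Fin n) (Fin p) ℝ} {v : ℝ≥0}
    {ε : (n : ℕ) → Fin n → Ω → ℝ}
    (hlaw : ∀ n i, HasLaw (ε n i) (gaussianReal 0 v) P) (hind : ∀ n, iIndepFun (ε n) P)
    {C : Matrix (Fin p) (Fin p) ℝ}
    (hXC : Tendsto (fun n : ℕ => normalizedGram (X n)) atTop (𝓝 C)) {δ : ℝ} (hδ : 0 < δ) :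
    ∃ M : ℝ, ∀ᶠ n in atTop,
      P {ω | ∃ j, M < |noiseScore (X n) (fun i => ε n i ω) j|} ≤ ENNReal.ofReal δ := by
  set D : ℝ := v * (∑ j, |C j j| + 1) with hD
  have hD0 : 0 ≤ D := by positivity
  -- Chebyshev and a union bound over `p` coordinates give `p * D / M ^ 2`, at most `δ` for this
  -- `M`; the `+ 1` keeps `M` positive.
  set M : ℝ := √(p * D / δ) + 1 with hM
  have hM0 : 0 < M := by positivity
  refine ⟨M, ?_⟩
  have hdiag : ∀ᶠ n in atTop, ∀ j, normalizedGram (X n) j j ≤ ∑ j, |C j j| + 1 := by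
    rw [eventually_all]
    intro j
    refine (tendsto_pi_nhds.1 (tendsto_pi_nhds.1 hXC j) j).eventually_le_const ?_
    have h1 : |C j j| ≤ ∑ j, |C j j| := Finset.single_le_sum (f := fun j => |C j j|)
      (fun i _ => abs_nonneg _) (Finset.mem_univ j)
    have h2 := le_abs_self (C j j)
    linarith
  filter_upwards [hdiag] with n hn
  have h1 : ∀ j, P {ω | M < |noiseScore (X n) (fun i => ε n i ω) j|} ≤
      ENNReal.ofReal (D / M ^ 2) := fun j => by
    have hl := hasLaw_noiseScore_dotProduct (X n) (hlaw n) (hind n) (Pi.single j 1)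
    simp only [dotProduct_single, mul_one] at hl
    refine (measure_abs_gt_le_of_hasLaw_gaussianReal hl hM0).trans ?_
    refine ENNReal.ofReal_le_ofReal ?_
    gcongr
    rw [NNReal.coe_mul, hD]
    gcongr
    rw [Real.coe_toNNReal', max_le_iff]
    refine ⟨?_, by positivity⟩
    simpa using hn j
  have h2 : {ω | ∃ j, M < |noiseScore (X n) (fun i => ε n i ω) j|} =
      ⋃ j, {ω | M < |noiseScore (X n) (fun i => ε n i ω) j|} := by
    ext; simp
  rw [h2]
  calc _ ≤ ∑ j, P {ω | M < |noiseScore (X n) (fun i => ε n i ω) j|} :=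
        measure_iUnion_fintype_le _ _
    _ ≤ ∑ j : Fin p, ENNReal.ofReal (D / M ^ 2) := Finset.sum_le_sum fun j _ => h1 j
    _ = ENNReal.ofReal (p * (D / M ^ 2)) := by
        rw [Finset.sum_const, Finset.card_univ, Fintype.card_fin, nsmul_eq_mul,
          ENNReal.ofReal_mul (by positivity), ENNReal.ofReal_natCast]
    _ ≤ ENNReal.ofReal δ := by
        refine ENNReal.ofReal_le_ofReal ?_
        rw [← mul_div_assoc, div_le_iff₀ (by positivity)]
        have h3 : p * D / δ ≤ M ^ 2 := by
          have h4 := Real.sq_sqrt (show 0 ≤ p * D / δ by positivity)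
          have h5 := Real.sqrt_nonneg (p * D / δ)
          nlinarith
        rw [div_le_iff₀ hδ] at h3
        linarith

/-! ### The leading term and its Gaussian limit -/

/-- Extension of a vector indexed by `S` by zero. -/
noncomputable def extendZero {ι : Type*} [DecidableEq ι] (S : Finset ι) (w : S → ℝ) : ι → ℝ :=
  fun j => if h : j ∈ S then w ⟨j, h⟩ else 0

lemma sum_mul_extendZero {ι : Type*} [Fintype ι] [DecidableEq ι] (S : Finset ι) (w : S → ℝ)
    (f : ι → ℝ) : ∑ j, f j * extendZero S w j = ∑ j : S, f j * w j := by
  have h1 : ∑ j : S, f j * w j = ∑ j : S, f j * extendZero S w j := by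
    refine Finset.sum_congr rfl fun j _ => ?_
    simp [extendZero]
  rw [h1, Finset.sum_coe_sort S fun j => f j * extendZero S w j]
  symm
  refine Finset.sum_subset (Finset.subset_univ _) fun j _ hj => ?_
  simp [extendZero, hj]

lemma extendZero_dotProduct_mulVec {ι : Type*} [Fintype ι] [DecidableEq ι] (S : Finset ι)
    (w : S → ℝ) (C : Matrix ι ι ℝ) :
    extendZero S w ⬝ᵥ C *ᵥ extendZero S w =
      w ⬝ᵥ C.submatrix (fun i : S => (i : ι)) (fun j : S => (j : ι)) *ᵥ w := by
  rw [dotProduct_comm, dotProduct, sum_mul_extendZero, dotProduct_comm w, dotProduct]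
  refine Finset.sum_congr rfl fun i _ => ?_
  congr 1
  exact sum_mul_extendZero S w _

/-- The Cramér–Wold device: it reduces a vector law to its one-dimensional projections. -/
lemma charFun_map_eq_charFun_map_inner {Ω E : Type*} [MeasurableSpace Ω] {P : Measure Ω}
    [NormedAddCommGroup E] [InnerProductSpace ℝ E] [MeasurableSpace E] [BorelSpace E]
    [SecondCountableTopology E] {V : Ω → E} (hV : AEMeasurable V P) (t : E) :
    charFun (P.map V) t = charFun (P.map fun ω => inner ℝ (V ω) t) 1 := by
  rw [charFun_apply, charFun_apply, integral_map hV (by fun_prop),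
    integral_map (by fun_prop) (by fun_prop)]
  simp

/-- The leading term `C_SS⁻¹ W_S` of the rescaled Adaptive Lasso error. -/
noncomputable def leadingTerm {n p : ℕ} (S : Finset (Fin p)) (C : Matrix (Fin p) (Fin p) ℝ)
    (X : Matrix (Fin n) (Fin p) ℝ) (e : Fin n → ℝ) : EuclideanSpace ℝ S :=
  WithLp.toLp 2 ((C.submatrix (fun i : S => (i : Fin p)) (fun j : S => (j : Fin p)))⁻¹ *ᵥ
    fun j : S => noiseScore X e j)

lemma aemeasurable_leadingTerm {Ω : Type*} [MeasurableSpace Ω] {P : Measure Ω} {n p : ℕ}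
    (S : Finset (Fin p)) (C : Matrix (Fin p) (Fin p) ℝ) (X : Matrix (Fin n) (Fin p) ℝ)
    {ε : Fin n → Ω → ℝ} (hε : ∀ i, AEMeasurable (ε i) P) :
    AEMeasurable (fun ω => leadingTerm S C X fun i => ε i ω) P := by
  have hc : Continuous fun e : Fin n → ℝ => leadingTerm S C X e := by
    unfold leadingTerm noiseScore
    fun_prop
  exact hc.measurable.comp_aemeasurable (aemeasurable_pi_lambda _ hε)

/-- Each projection is exactly Gaussian for every `n`, so its characteristic function is explicit.
Its variance converges because the Gram matrix does, and Lévy's continuity theorem concludes. -/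
lemma tendstoInDistribution_leadingTerm {Ω : Type*} [MeasurableSpace Ω] {P : Measure Ω}
    [IsProbabilityMeasure P] {p : ℕ} {X : (n : ℕ) → Matrix (Fin n) (Fin p) ℝ} {σ : ℝ≥0}
    {ε : (n : ℕ) → Fin n → Ω → ℝ}
    (hlaw : ∀ n i, HasLaw (ε n i) (gaussianReal 0 (σ ^ 2)) P) (hind : ∀ n, iIndepFun (ε n) P)
    {C : Matrix (Fin p) (Fin p) ℝ} (hC : C.PosDef)
    (hXC : Tendsto (fun n : ℕ => normalizedGram (X n)) atTop (𝓝 C)) (S : Finset (Fin p)) :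
    TendstoInDistribution (fun (n : ℕ) ω => leadingTerm S C (X n) fun i => ε n i ω) atTop
      (id : EuclideanSpace ℝ S → EuclideanSpace ℝ S) (fun _ => P)
      (multivariateGaussian 0
        ((σ : ℝ) ^ 2 • (C.submatrix (fun i : S => (i : Fin p)) (fun j : S => (j : Fin p)))⁻¹)) := by
  set A := C.submatrix (fun i : S => (i : Fin p)) (fun j : S => (j : Fin p)) with hA
  have hApd : A.PosDef := hC.submatrix Subtype.val_injective
  have hdet : IsUnit A.det := (Matrix.isUnit_iff_isUnit_det A).1 hApd.isUnit
  have hsym : (A⁻¹)ᵀ = A⁻¹ := by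
    have := hApd.inv.isHermitian
    simpa [Matrix.IsHermitian] using this
  have hpsd : ((σ : ℝ) ^ 2 • A⁻¹).PosSemidef := hApd.inv.posSemidef.smul (by positivity)
  have hm : ∀ n, AEMeasurable (fun ω => leadingTerm S C (X n) fun i => ε n i ω) P :=
    fun n => aemeasurable_leadingTerm S C (X n) fun i => (hlaw n i).aemeasurable
  refine ⟨hm, aemeasurable_id, ProbabilityMeasure.tendsto_of_tendsto_charFun fun t => ?_⟩
  simp only [ProbabilityMeasure.coe_mk, Measure.map_id]
  rw [charFun_multivariateGaussian hpsd]
  -- By symmetry `A⁻¹` moves onto `t`; padding `w` with zeros turns the projection into a linear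
  -- functional of the full score.
  set w : S → ℝ := A⁻¹ *ᵥ t.ofLp with hw
  have hinner : ∀ (n : ℕ) ω, inner ℝ (leadingTerm S C (X n) fun i => ε n i ω) t =
      noiseScore (X n) (fun i => ε n i ω) ⬝ᵥ extendZero S w := fun n ω => by
    rw [dotProduct, sum_mul_extendZero, EuclideanSpace.inner_eq_star_dotProduct, star_trivial]
    change t.ofLp ⬝ᵥ (A⁻¹ *ᵥ fun j : S => noiseScore (X n) (fun i => ε n i ω) j) = _
    rw [dotProduct_mulVec, ← mulVec_transpose, hsym, dotProduct_comm]
    rfl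
  have hchar : ∀ n : ℕ, charFun (P.map fun ω => leadingTerm S C (X n) fun i => ε n i ω) t =
      Complex.exp ((-((σ : ℝ) ^ 2 *
        (max (extendZero S w ⬝ᵥ normalizedGram (X n) *ᵥ extendZero S w) 0) / 2) : ℝ)) :=
    fun n => by
      rw [charFun_map_eq_charFun_map_inner (hm n)]
      simp_rw [hinner n]
      rw [(hasLaw_noiseScore_dotProduct (X n) (hlaw n) (hind n) _).map_eq, charFun_gaussianReal]
      congr 1
      push_cast [Real.coe_toNNReal']
      ring
  have hlim : w ⬝ᵥ A *ᵥ w = t.ofLp ⬝ᵥ A⁻¹ *ᵥ t.ofLp := by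
    rw [hw, mulVec_mulVec, Matrix.mul_nonsing_inv _ hdet, one_mulVec, dotProduct_comm]
  have hpos : 0 ≤ t.ofLp ⬝ᵥ A⁻¹ *ᵥ t.ofLp := by
    simpa using hApd.inv.posSemidef.dotProduct_mulVec_nonneg t.ofLp
  have hq : Tendsto (fun n => max (extendZero S w ⬝ᵥ normalizedGram (X n) *ᵥ extendZero S w) 0)
      atTop (𝓝 (t.ofLp ⬝ᵥ A⁻¹ *ᵥ t.ofLp)) := by
    have hc : Continuous fun G : Matrix (Fin p) (Fin p) ℝ =>
        max (extendZero S w ⬝ᵥ G *ᵥ extendZero S w) 0 := by fun_prop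
    have := (hc.tendsto C).comp hXC
    rw [extendZero_dotProduct_mulVec, ← hA, hlim, max_eq_left hpos] at this
    exact this
  have h1 : Complex.exp ((inner ℝ t (0 : EuclideanSpace ℝ S) : ℝ) * Complex.I -
      (t.ofLp ⬝ᵥ ((σ : ℝ) ^ 2 • A⁻¹) *ᵥ t.ofLp : ℝ) / 2) =
      Complex.exp ((-((σ : ℝ) ^ 2 * (t.ofLp ⬝ᵥ A⁻¹ *ᵥ t.ofLp) / 2) : ℝ)) := by
    rw [smul_mulVec, dotProduct_smul, inner_zero_right]
    push_cast
    congr 1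
    simp
  rw [h1]
  simp_rw [hchar]
  exact (Complex.continuous_exp.tendsto _).comp
    ((Complex.continuous_ofReal.tendsto _).comp (((hq.const_mul _).div_const 2).neg))

/-- As `u` vanishes off `S`, the `S`-rows of `C u` are `C_SS u_S`. Applying `C_SS⁻¹` to the score
equation multiplies the error by at most the entry sum `B` of that inverse. -/
lemma exists_norm_sub_leadingTerm_le {p : ℕ} {C : Matrix (Fin p) (Fin p) ℝ} (hC : C.PosDef)
    (S : Finset (Fin p)) :
    ∃ B : ℝ, 0 ≤ B ∧ ∀ {n : ℕ} (X : Matrix (Fin n) (Fin p) ℝ) (e : Fin n → ℝ)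
      (u : EuclideanSpace ℝ (Fin p)) (η : ℝ), (∀ j ∉ S, u j = 0) →
      (∀ j ∈ S, |noiseScore X e j - (C *ᵥ u.ofLp) j| ≤ η) →
      ‖subvector S u - leadingTerm S C X e‖ ≤ B * η := by
  set A := C.submatrix (fun i : S => (i : Fin p)) (fun j : S => (j : Fin p)) with hA
  have hApd : A.PosDef := hC.submatrix Subtype.val_injective
  have hdet : IsUnit A.det := (Matrix.isUnit_iff_isUnit_det A).1 hApd.isUnit
  refine ⟨∑ i : S, ∑ k : S, |A⁻¹ i k|, by positivity, fun {n} X e u η hu hη => ?_⟩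
  have hCu : ∀ j : S, (C *ᵥ u.ofLp) j = (A *ᵥ (subvector S u).ofLp) j := fun j => by
    have h1 : u.ofLp = extendZero S (subvector S u).ofLp := by
      ext j
      by_cases hj : j ∈ S
      · simp [extendZero, hj, subvector]
      · simp [extendZero, hj, hu j hj]
    conv_lhs => rw [h1]
    exact sum_mul_extendZero S _ _
  set d : S → ℝ := fun j => (C *ᵥ u.ofLp) j - noiseScore X e j with hd
  have hdη : ∀ j : S, |d j| ≤ η := fun j => by
    rw [hd, abs_sub_comm]; exact hη j j.2
  have h2 : subvector S u - leadingTerm S C X e = WithLp.toLp 2 (A⁻¹ *ᵥ d) := by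
    have h3 : d = A *ᵥ (subvector S u).ofLp - fun j : S => noiseScore X e j := by
      ext j
      simp [hd, hCu]
    rw [h3, mulVec_sub, mulVec_mulVec, Matrix.nonsing_inv_mul _ hdet, one_mulVec]
    rfl
  rw [h2]
  calc ‖WithLp.toLp 2 (A⁻¹ *ᵥ d)‖ ≤ ∑ i : S, |(A⁻¹ *ᵥ d) i| := by
        rw [EuclideanSpace.norm_eq]
        refine (Real.sqrt_le_sqrt ?_).trans
          (Real.sqrt_sq (Finset.sum_nonneg fun i _ => abs_nonneg ((A⁻¹ *ᵥ d) i))).le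
        simpa using Finset.sum_sq_le_sq_sum_of_nonneg (s := Finset.univ)
          (f := fun i : S => |(A⁻¹ *ᵥ d) i|) fun i _ => abs_nonneg _
    _ ≤ ∑ i : S, ∑ k : S, |A⁻¹ i k| * η := by
        refine Finset.sum_le_sum fun i _ => (Finset.abs_sum_le_sum_abs _ _).trans
          (Finset.sum_le_sum fun k _ => ?_)
        rw [abs_mul]
        gcongr
        exact hdη k
    _ = _ := by simp only [Finset.sum_mul]

lemma subvector_smul_sub {p : ℕ} (S : Finset (Fin p)) (r : ℝ) (β β' : EuclideanSpace ℝ (Fin p)) :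
    subvector S (r • (β - β')) = r • (subvector S β - subvector S β') := rfl

lemma continuous_subvector {p : ℕ} (S : Finset (Fin p)) :
    Continuous (subvector S : EuclideanSpace ℝ (Fin p) → EuclideanSpace ℝ S) := by
  unfold subvector
  fun_prop

lemma tendsto_measure_zero_of_forall_le_ofReal {Ω : Type*} [MeasurableSpace Ω] {P : Measure Ω}
    {s : ℕ → Set Ω} (h : ∀ δ : ℝ, 0 < δ → ∀ᶠ n in atTop, P (s n) ≤ ENNReal.ofReal δ) :
    Tendsto (fun n => P (s n)) atTop (𝓝 0) := by
  rw [ENNReal.tendsto_nhds_zero]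
  intro δ hδ
  rcases eq_or_ne δ ⊤ with rfl | hδ'
  · simp
  · filter_upwards [h δ.toReal (ENNReal.toReal_pos hδ.ne' hδ')] with n hn
    rwa [ENNReal.ofReal_toReal hδ'] at hn

/-! ### Transfer to probability -/

theorem mainTheorem11 {Ω : Type*} [MeasurableSpace Ω] (P : Measure Ω) [IsProbabilityMeasure P]
    {p : ℕ}
    -- the linear model `y = X β* + ε` with i.i.d. `N(0, σ²)` noise
    (X : (n : ℕ) → Matrix (Fin n) (Fin p) ℝ) (βstar : EuclideanSpace ℝ (Fin p)) (σ : ℝ≥0)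
    (ε : (n : ℕ) → Fin n → Ω → ℝ)
    (hε_law : ∀ n i, HasLaw (ε n i) (gaussianReal 0 (σ ^ 2)) P)
    (hε_indep : ∀ n, iIndepFun (ε n) P)
    (y : (n : ℕ) → Ω → Fin n → ℝ)
    (hy : ∀ n ω i, y n ω i = (X n *ᵥ βstar.ofLp) i + ε n i ω)
    -- the design
    (C : Matrix (Fin p) (Fin p) ℝ) (hC : C.PosDef)
    (hXC : Tendsto (fun n : ℕ => (1 / (n : ℝ)) • ((X n)ᵀ * X n)) atTop (𝓝 C))
    (hXmax : Tendsto (fun n : ℕ => (1 / (n : ℝ)) * ⨆ i : Fin n, ∑ j, (X n i j) ^ 2)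
      atTop (𝓝 0))
    -- the `√m`-consistent initial estimator
    (m : ℕ → ℕ) (βinit : ℕ → Ω → EuclideanSpace ℝ (Fin p))
    (hβinit_meas : ∀ n, AEMeasurable (βinit n) P)
    (hβinit : IsRootConsistent P m βinit βstar)
    -- the tuning parameters
    (γ : ℝ) (hγ : 0 < γ) (lam : ℕ → ℝ) (hlam : ∀ n, 0 ≤ lam n)
    (hlam_zero : Tendsto (fun n : ℕ => lam n / √(n : ℝ)) atTop (𝓝 0))
    (hlam_top : Tendsto (fun n : ℕ => lam n * √((m n : ℝ) ^ γ / (n : ℝ))) atTop atTop)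
    -- the Adaptive Lasso estimator
    (βhat : ℕ → Ω → EuclideanSpace ℝ (Fin p))
    (hβhat_meas : ∀ n, AEMeasurable (βhat n) P)
    (hβhat : ∀ n, ∀ᵐ ω ∂P, IsAdaptiveLasso (X n) (y n ω) (lam n) γ (βinit n ω) (βhat n ω)) :
    Tendsto (fun n => P {ω | activeSet (βhat n ω) = activeSet βstar}) atTop (𝓝 1) ∧
    IsRootConsistent P (fun n => n) βhat βstar ∧
    TendstoInDistribution
      (fun (n : ℕ) ω => √(n : ℝ) • (subvector (activeSet βstar) (βhat n ω) -
        subvector (activeSet βstar) βstar))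
      atTop (id : EuclideanSpace ℝ (activeSet βstar) → EuclideanSpace ℝ (activeSet βstar))
      (fun _ => P)
      (multivariateGaussian 0
        ((σ : ℝ) ^ 2 • (C.submatrix (fun i : activeSet βstar => (i : Fin p))
          (fun j : activeSet βstar => (j : Fin p)))⁻¹)) := by
  change Tendsto (fun n : ℕ => normalizedGram (X n)) atTop (𝓝 C) at hXC
  simp_rw [sqrt_rpow_div_eq] at hlam_top
  set S := activeSet βstar with hS
  -- the oracle event has probability close to one
  have key : ∀ δ : ℝ, 0 < δ → ∃ U : ℝ, ∀ η : ℝ, 0 < η → ∀ᶠ n : ℕ in atTop,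
      P {ω | ¬ (√(n : ℝ) * ‖βhat n ω - βstar‖ ≤ U ∧ activeSet (βhat n ω) = S ∧
        ∀ j ∈ S, |noiseScore (X n) (fun i => ε n i ω) j -
          (C *ᵥ (√(n : ℝ) • (βhat n ω - βstar)).ofLp) j| ≤ η)} ≤ ENNReal.ofReal δ := by
    intro δ hδ
    obtain ⟨M₁, hM₁⟩ := exists_noiseScore_bound hε_law hε_indep hXC (half_pos hδ)
    obtain ⟨M₂, hM₂⟩ := hβinit (δ / 2) (half_pos hδ)
    have hM : 0 < max (max M₁ M₂) 1 := lt_max_of_lt_right one_pos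
    obtain ⟨U, hU⟩ := oracle_of_bounded_score X βstar hC hXC m hγ hlam_zero hlam_top hM
    refine ⟨U, fun η hη => ?_⟩
    filter_upwards [hM₁, hM₂, hU η hη] with n h1 h2 h3
    have h4 : P {ω | ¬ IsAdaptiveLasso (X n) (y n ω) (lam n) γ (βinit n ω) (βhat n ω)} = 0 :=
      hβhat n
    calc _ ≤ P (({ω | ∃ j, M₁ < |noiseScore (X n) (fun i => ε n i ω) j|} ∪
            {ω | M₂ < √(m n : ℝ) * ‖βinit n ω - βstar‖}) ∪
            {ω | ¬ IsAdaptiveLasso (X n) (y n ω) (lam n) γ (βinit n ω) (βhat n ω)}) := by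
          refine measure_mono fun ω hω => ?_
          by_contra hcon
          simp only [Set.mem_union, Set.mem_ofPred_eq, not_or, not_exists, not_lt, not_not] at hcon
          exact hω (h3 (y n ω) (fun i => ε n i ω) (βinit n ω) (βhat n ω) (hy n ω) hcon.2
            (fun j => (hcon.1.1 j).trans ((le_max_left _ _).trans (le_max_left _ _)))
            (hcon.1.2.trans ((le_max_right _ _).trans (le_max_left _ _))))
      _ ≤ ENNReal.ofReal (δ / 2) + ENNReal.ofReal (δ / 2) + 0 :=
          (measure_union_le _ _).trans (add_le_add ((measure_union_le _ _).trans
            (add_le_add h1 h2)) h4.le)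
      _ = ENNReal.ofReal δ := by
          rw [add_zero, ← ENNReal.ofReal_add (by positivity) (by positivity), add_halves]
  refine ⟨?_, ?_, ?_⟩
  · have hbad : Tendsto (fun n => P {ω | ¬ activeSet (βhat n ω) = S}) atTop (𝓝 0) := by
      refine tendsto_measure_zero_of_forall_le_ofReal fun δ hδ => ?_
      obtain ⟨U, hU⟩ := key δ hδ
      filter_upwards [hU 1 one_pos] with n hn
      refine (measure_mono fun ω hω h => ?_).trans hn
      exact hω h.2.1
    -- Subadditivity gives `1 - P(bad) ≤ P(good)` without measurability of the selection event.
    have hlow : Tendsto (fun n => 1 - P {ω | ¬ activeSet (βhat n ω) = S}) atTop (𝓝 1) := by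
      simpa using ENNReal.Tendsto.sub (tendsto_const_nhds (x := (1 : ℝ≥0∞))) hbad
        (Or.inl ENNReal.one_ne_top)
    refine tendsto_of_tendsto_of_tendsto_of_le_of_le hlow tendsto_const_nhds (fun n => ?_)
      fun n => prob_le_one
    rw [tsub_le_iff_right]
    calc (1 : ℝ≥0∞) = P Set.univ := measure_univ.symm
      _ ≤ P ({ω | activeSet (βhat n ω) = S} ∪ {ω | ¬ activeSet (βhat n ω) = S}) :=
          measure_mono fun ω _ => em _
      _ ≤ _ := measure_union_le _ _
  · intro δ hδ
    obtain ⟨U, hU⟩ := key δ hδ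
    refine ⟨U, ?_⟩
    filter_upwards [hU 1 one_pos] with n hn
    refine (measure_mono fun ω hω h => ?_).trans hn
    exact absurd h.1 (not_le.2 hω)
  · have hmeas : ∀ n : ℕ, AEMeasurable (fun ω => √(n : ℝ) • (subvector S (βhat n ω) -
        subvector S βstar)) P := fun n =>
      ((continuous_subvector S).measurable.comp_aemeasurable (hβhat_meas n)).sub_const
        (subvector S βstar) |>.const_smul (√(n : ℝ))
    -- Slutsky: it suffices that the distance to the leading term tends to `0` in probability.
    refine tendstoInDistribution_of_tendstoInMeasure_sub _ _
      (tendstoInDistribution_leadingTerm hε_law hε_indep hC hXC S) ?_ hmeas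
    obtain ⟨B, hB0, hB⟩ := exists_norm_sub_leadingTerm_le hC S
    rw [tendstoInMeasure_iff_norm]
    intro τ hτ
    refine tendsto_measure_zero_of_forall_le_ofReal fun δ hδ => ?_
    obtain ⟨U, hU⟩ := key δ hδ
    -- With this accuracy the distance is at most `B * η < τ`; `B + 1` covers `B = 0`.
    filter_upwards [hU (τ / (2 * (B + 1))) (by positivity)] with n hn
    refine (measure_mono fun ω hω h => ?_).trans hn
    have h1 := hB (X n) (fun i => ε n i ω) (√(n : ℝ) • (βhat n ω - βstar)) _ (fun j hj => ?_) h.2.2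
    · rw [subvector_smul_sub] at h1
      have h2 : τ ≤ B * (τ / (2 * (B + 1))) := by
        refine le_trans ?_ h1
        simpa using hω
      have h3 : B * (τ / (2 * (B + 1))) < τ := by
        rw [← mul_div_assoc, div_lt_iff₀ (by positivity)]
        nlinarith
      linarith
    · have h4 : βstar j = 0 := by simpa [hS, activeSet] using hj
      have h5 : βhat n ω j = 0 := by
        rw [← h.2.1] at hj
        simpa [activeSet] using hj
      simp [h4, h5]
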